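/- Let $d,m,r\ge 0$ be integers and let $G=\mathbb F_d * \mathbb Z/2\mathbb Z*\cdots*\mathbb Z/2\mathbb Z$ ($m$ factors $\mathbb Z/2\mathbb Z$), with identity $e$ and generating set $S=\{a_1^{\pm1},\dots,a_d^{\pm1},b_1,\dots,b_m\}$, where the $a_i$ are the free generators and $b_j$ is the nontrivial element of the $j$-th factor $\mathbb Z/2\mathbb Z$. Let $(p_g)_{g\in G}$ be nonnegative real $r\times r$ matrices with $p_g=0$ for $g\notin S$ such that $\sum_g p_g$ is stochastic, and let $(X_n)_{n\ge0}$ be the corresponding nearest-neighbor colored random walk, that is, the Markov chain on $G\times[r]$ that moves from $(g,u)$ to $(h,v)$ with probability $p_{g^{-1}h}(u,v)$. Write $\mathbb P_u$ for its law when $X_0=(e,u)$. Assume that the walk is transient: for every $u\in[r]$, $\mathbb P_u$-almost surely each state of $G\times[r]$ is visited only finitely often. Then for every $u$, $\mathbb P_u$-almost surely the $G$-component of $X_n$ converges to a unique infinite reduced word $X_\infty=\xi_1\xi_2\cdots$ (with $\xi_i\in S$ and $\xi_{i+1}\neq\xi_i^{-1}$), in the sense that for each $k$ the reduced word of the $G$-component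 of $X_n$ begins with $\xi_1\cdots\xi_k$ for all large $n$. For $g\in S$ let $\tau_g$ and $\tau_{(g,v)}$ be the first times at which $X_n$ has $G$-component $g$, respectively is equal to $(g,v)$, and define $r\times r$ matrices by $$q_g(u,v)=\mathbb P_u[\tau_g<\infty,\ \tau_g=\tau_{(g,v)}],\qquad \mu_g(u,v)=\mathbb P_u[\xi_1=g,\ X_{\tau_g}=(g,v)],$$ and let $d_g$ be the diagonal matrix with entries $d_g(u,u)=\sum_{w}q_g(u,w)$. Then for every $g\in S$ the matrix $I-q_{g^{-1}}q_g$ is invertible, and for all $u,v\in[r]$ $$\mu_g(u,v)=q_g(u,v)\sum_{w\in[r]}\bigl((I-q_{g^{-1}}q_g)^{-1}(I-d_{g^{-1}})\bigr)(v,w).$$ -/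

import Mathlib

open MeasureTheory Filter

/-- The free product `F_d * Z/2 * ... * Z/2` of the free group on `d` generators with `m` copies of
the group of order two. -/
abbrev FreeGp (d m : ℕ) : Type :=
  Monoid.Coprod (FreeGroup (Fin d)) (Monoid.CoprodI (fun _ : Fin m => Multiplicative (ZMod 2)))

namespace FreeGp

variable {d m : ℕ}

/-- The free generator `a_i`. -/
def a (i : Fin d) : FreeGp d m := Monoid.Coprod.inl (FreeGroup.of i)

/-- The nontrivial element `b_j` of the `j`-th factor `Z/2`. -/
def b (j : Fin m) : FreeGp d m :=
  Monoid.Coprod.inr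
    (Monoid.CoprodI.of (M := fun _ : Fin m => Multiplicative (ZMod 2)) (i := j)
      (Multiplicative.ofAdd 1))

/-- The symmetric generating set `S`: all `a_i`, all `a_i⁻¹` and all `b_j`. -/
def S (d m : ℕ) : Set (FreeGp d m) :=
  {g | (∃ i, g = a i) ∨ (∃ i, g = (a i)⁻¹) ∨ ∃ j, g = b j}

/-- The letters that may follow `g` in a reduced word. For `g = b_j` this removes `b_j` itself. -/
def Next (g : FreeGp d m) : Set (FreeGp d m) := S d m \ {g⁻¹}

/-- Finite reduced words. -/
def IsReducedWord (w : List (FreeGp d m)) : Prop :=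
  (∀ g ∈ w, g ∈ S d m) ∧ w.IsChain (fun g h => h ∈ Next g)

/-- Infinite reduced words: the points of the boundary of the group. -/
def IsBoundaryPoint (ξ : ℕ → FreeGp d m) : Prop :=
  (∀ i, ξ i ∈ S d m) ∧ ∀ i, ξ (i + 1) ∈ Next (ξ i)

/-- The sequence `x` of group elements converges to the infinite word `ξ`: for every `k`, the first
`k` letters of the reduced word of `x n` are those of `ξ`, for all large `n`. -/
def ConvergesTo (x : ℕ → FreeGp d m) (ξ : ℕ → FreeGp d m) : Prop :=
  ∀ k : ℕ, ∀ᶠ n in atTop,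
    ∃ w : List (FreeGp d m), IsReducedWord w ∧ w.prod = x n ∧ (List.range k).map ξ <+: w

end FreeGp

/-- A family `(p_g)` of nonnegative matrices whose sum over `g` is a stochastic matrix. -/
structure IsColoredKernel {G : Type*} {r : ℕ} (p : G → Matrix (Fin r) (Fin r) ℝ) : Prop where
  nonneg : ∀ g u v, 0 ≤ p g u v
  stochastic : ∀ u, HasSum (fun x : G × Fin r => p x.1 u x.2) 1

/-- Under `ℙ`, the process `X` is the Markov chain on `G × [r]` started at `(e, u)` which moves from
`(g, v)` to `(h, w)` with probability `p_{g⁻¹h}(v, w)`. -/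
structure IsColoredWalk {G : Type*} [Group G] {r : ℕ} {Ω : Type*} [MeasurableSpace Ω]
    (p : G → Matrix (Fin r) (Fin r) ℝ) (u : Fin r) (ℙ : Measure Ω)
    (X : ℕ → Ω → G × Fin r) : Prop where
  isProbabilityMeasure : IsProbabilityMeasure ℙ
  measurable : ∀ n x, MeasurableSet {ω | X n ω = x}
  start : ∀ᵐ ω ∂ℙ, X 0 ω = (1, u)
  markov : ∀ (n : ℕ) (x : ℕ → G × Fin r),
    ℙ.real {ω | ∀ k ≤ n + 1, X k ω = x k} =
      ℙ.real {ω | ∀ k ≤ n, X k ω = x k} * p ((x n).1⁻¹ * (x (n + 1)).1) (x n).2 (x (n + 1)).2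

namespace ColoredWalk

variable {G : Type*} {r : ℕ} {Ω : Type*}

/-- Transience: from each starting color, almost surely every state is visited only finitely often.
(The walk started at `(g, u)` is the translate by `g` of the walk started at `(e, u)`.) -/
def IsTransient [MeasurableSpace Ω] (ℙ : Fin r → Measure Ω) (X : ℕ → Ω → G × Fin r) : Prop :=
  ∀ (u : Fin r) (x : G × Fin r), ∀ᵐ ω ∂ℙ u, ∀ᶠ n in atTop, X n ω ≠ x

/-- The hitting time of a set of states, `⊤` if it is never visited. -/
noncomputable def hitTime (X : ℕ → Ω → G × Fin r) (A : Set (G × Fin r)) (ω : Ω) : ℕ∞ :=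
  sInf ((fun n : ℕ => (n : ℕ∞)) '' {n | X n ω ∈ A})

/-- `τ_g`, the hitting time of `g` with any color. -/
noncomputable def tau (X : ℕ → Ω → G × Fin r) (g : G) (ω : Ω) : ℕ∞ :=
  hitTime X {x | x.1 = g} ω

/-- `q_g(u, v)`: the probability, starting from `(e, u)`, that `g` is visited and that the first
visit happens with color `v`. -/
noncomputable def q [MeasurableSpace Ω] (ℙ : Fin r → Measure Ω) (X : ℕ → Ω → G × Fin r) (g : G) :
    Matrix (Fin r) (Fin r) ℝ :=
  Matrix.of fun u v => (ℙ u).real {ω | tau X g ω < ⊤ ∧ tau X g ω = hitTime X {(g, v)} ω}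

/-- The diagonal matrix `d_g` of the probabilities of ever visiting `g`. -/
noncomputable def dmat [MeasurableSpace Ω] (ℙ : Fin r → Measure Ω) (X : ℕ → Ω → G × Fin r)
    (g : G) : Matrix (Fin r) (Fin r) ℝ :=
  Matrix.diagonal fun u => ∑ w, q ℙ X g u w

/-- `ξ` is the limit `X_∞(ω)` of the trajectory in the boundary of the group. -/
def IsLimit {d m : ℕ} (X : ℕ → Ω → FreeGp d m × Fin r) (ω : Ω) (ξ : ℕ → FreeGp d m) : Prop :=
  FreeGp.IsBoundaryPoint ξ ∧ FreeGp.ConvergesTo (fun n => (X n ω).1) ξ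

/-- `μ_g(u, v)`: the probability, starting from `(e, u)`, that the first letter of `X_∞` is `g` and
that `X` is in the state `(g, v)` at time `τ_g`. -/
noncomputable def mu [MeasurableSpace Ω] {d m : ℕ} (ℙ : Fin r → Measure Ω)
    (X : ℕ → Ω → FreeGp d m × Fin r) (g : FreeGp d m) : Matrix (Fin r) (Fin r) ℝ :=
  Matrix.of fun u v => (ℙ u).real
    {ω | (∃ ξ, IsLimit X ω ξ ∧ ξ 0 = g) ∧ ∃ n : ℕ, tau X g ω = n ∧ X n ω = (g, v)}

end ColoredWalk

/-! The Cayley graph of `S` is a tree: by van der Waerden's argument, the group acts on reduced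
words, and the orbit of the empty word gives each element exactly one normal form
(`existsUnique_isReducedWord`). A nearest-neighbor step changes only the end of the normal form.
Since balls are finite, transience makes the length tend to infinity, hence every letter stabilizes,
and this is the limit.

In a tree, a path from the identity cannot enter the cone of $g$ without visiting $g$. By the strong
Markov property at the first visit (`markov_hit`) and translation by $g^{-1}$, the limit begins with
$g$ exactly when $g$ is visited and the restarted walk has a limit not beginning with $g^{-1}$. So
$\mu_g(u,v)=q_g(u,v)h(v)$ with $h(v)=1-\sum_w\mu_{g^{-1}}(v,w)$ (`limitMatrix_eq_mul`). The same
identity for $g^{-1}$ gives $h=1-q_{g^{-1}}(1-q_gh)$, that is, $(I-q_{g^{-1}}q_g)h=(I-d_{g^{-1}})1$.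

The matrix on the left is invertible because a fixed vector of $q_{g^{-1}}q_g$ is bounded, up to a
constant, by the probability of a visit to the identity after time $2k$, for every $k$; transience
sends this to $0$. -/

/-! ### Normal forms in the free product -/

namespace FreeGp

variable {d m : ℕ}

/-- Symbols for the elements of the generating set: `inl (i, true)` stands for `a i`,
`inl (i, false)` for its inverse and `inr j` for `b j`. -/
abbrev Letter (d m : ℕ) : Type := (Fin d × Bool) ⊕ Fin m

/-- The formal inverse of a letter. -/
def Letter.inv : Letter d m → Letter d m
  | .inl (i, c) => .inl (i, !c)
  | .inr j => .inr j

theorem Letter.inv_inv (l : Letter d m) : l.inv.inv = l := by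
  rcases l with ⟨i, c⟩ | j <;> simp [Letter.inv]

/-- The group element denoted by a letter. -/
def Letter.val : Letter d m → FreeGp d m
  | .inl (i, c) => if c then a i else (a i)⁻¹
  | .inr j => b j

theorem b_mul_b (j : Fin m) : (b j : FreeGp d m) * b j = 1 := by
  have h : (Multiplicative.ofAdd 1 * Multiplicative.ofAdd 1 : Multiplicative (ZMod 2)) = 1 := by
    decide
  rw [b, ← map_mul, ← map_mul, h, map_one, map_one]

theorem b_inv (j : Fin m) : (b j : FreeGp d m)⁻¹ = b j :=
  (eq_inv_of_mul_eq_one_left (a := (b j : FreeGp d m)) (b_mul_b j)).symm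

theorem Letter.val_inv (l : Letter d m) : l.inv.val = l.val⁻¹ := by
  rcases l with ⟨i, c⟩ | j
  · cases c
    · exact (_root_.inv_inv (a i : FreeGp d m)).symm
    · rfl
  · exact (b_inv j).symm

theorem range_val : Set.range (Letter.val : Letter d m → FreeGp d m) = S d m := by
  ext g
  simp only [Set.mem_range, S, Set.mem_ofPred_eq]
  constructor
  · rintro ⟨⟨i, c⟩ | j, rfl⟩
    · cases c
      · exact .inr (.inl ⟨i, rfl⟩)
      · exact .inl ⟨i, rfl⟩
    · exact .inr (.inr ⟨j, rfl⟩)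
  · rintro (⟨i, rfl⟩ | ⟨i, rfl⟩ | ⟨j, rfl⟩)
    · exact ⟨.inl (i, true), rfl⟩
    · exact ⟨.inl (i, false), rfl⟩
    · exact ⟨.inr j, rfl⟩

theorem finite_S : (S d m).Finite := by
  rw [← range_val]; exact Set.finite_range _

theorem inv_mem_S {g : FreeGp d m} (hg : g ∈ S d m) : g⁻¹ ∈ S d m := by
  rw [← range_val] at hg ⊢
  obtain ⟨l, rfl⟩ := hg
  exact ⟨l.inv, l.val_inv⟩

/-- Reduced words in the letters. -/
abbrev LetterWord (d m : ℕ) : Type :=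
  {w : List (Letter d m) // w.IsChain (fun x y => y ≠ x.inv)}

/-- Left multiplication of a reduced word by a letter, followed by reduction. -/
def LetterWord.cons (l : Letter d m) : LetterWord d m → LetterWord d m
  | ⟨[], _⟩ => ⟨[l], by simp⟩
  | ⟨x :: w, h⟩ => if hx : x = l.inv then ⟨w, h.tail⟩ else ⟨l :: x :: w, by simp [h, hx]⟩

/-- If `l` cancels the first letter, the new first letter is not `l`, because the word was reduced;
so prepending `l.inv` restores the word without a second cancellation. -/
theorem LetterWord.cons_inv_cons (l : Letter d m) (w : LetterWord d m) :
    (w.cons l).cons l.inv = w := by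
  obtain ⟨w, h⟩ := w
  match w, h with
  | [], h => simp [LetterWord.cons, Letter.inv_inv]
  | [x], h =>
    by_cases hx : x = l.inv
    · subst hx; simp [LetterWord.cons]
    · simp [LetterWord.cons, hx, Letter.inv_inv]
  | x :: y :: w, h =>
    by_cases hx : x = l.inv
    · subst hx
      have hy : y ≠ l := by
        have := (List.isChain_cons_cons.1 h).1
        rwa [Letter.inv_inv] at this
      simp [LetterWord.cons, hy, Letter.inv_inv]
    · simp [LetterWord.cons, hx, Letter.inv_inv]

/-- Multiplication by a letter, as a permutation of the reduced words. -/
def LetterWord.perm (l : Letter d m) : Equiv.Perm (LetterWord d m) where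
  toFun := LetterWord.cons l
  invFun := LetterWord.cons l.inv
  left_inv := LetterWord.cons_inv_cons l
  right_inv w := by
    simpa only [Letter.inv_inv] using LetterWord.cons_inv_cons l.inv w

theorem LetterWord.perm_inv (l : Letter d m) : LetterWord.perm l.inv = (LetterWord.perm l)⁻¹ := by
  ext1 w; rfl

/-- The homomorphism from the group of order two determined by an involution. -/
def zmodTwoHom {H : Type*} [Group H] (x : H) (hx : x * x = 1) : Multiplicative (ZMod 2) →* H where
  toFun n := x ^ n.toAdd.val
  map_one' := by simp
  map_mul' y z := by
    have h : ∀ y z : ZMod 2, x ^ (y + z).val = x ^ y.val * x ^ z.val := by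
      intro y z
      -- Exponents matter only modulo `orderOf x`, which divides 2.
      rw [← pow_add, ZMod.val_add, ← pow_mod_orderOf x ((y.val + z.val) % 2),
        ← pow_mod_orderOf x (y.val + z.val)]
      congr 1
      exact Nat.mod_mod_of_dvd _ (orderOf_dvd_of_pow_eq_one (by rw [pow_two, hx]))
    exact h y.toAdd z.toAdd

/-- The action of the group on the reduced words. -/
def wordAction (d m : ℕ) : FreeGp d m →* Equiv.Perm (LetterWord d m) :=
  Monoid.Coprod.lift
    (FreeGroup.lift fun i => LetterWord.perm (.inl (i, true)))
    (Monoid.CoprodI.lift fun j => zmodTwoHom (LetterWord.perm (.inr j)) (by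
      ext1 w; exact LetterWord.cons_inv_cons (.inr j) w))

theorem wordAction_val (l : Letter d m) : wordAction d m l.val = LetterWord.perm l := by
  rcases l with ⟨i, c⟩ | j
  · cases c
    · rw [show (.inl (i, false) : Letter d m) = (Letter.inv (.inl (i, true))) from rfl,
        Letter.val_inv, LetterWord.perm_inv]
      refine (map_inv (wordAction d m) (a i)).trans ?_
      simp [a, wordAction]
    · simp [Letter.val, a, wordAction]
  · have h : (1 : ZMod 2).val = 1 := rfl
    simp [Letter.val, b, wordAction, zmodTwoHom, h]

/-- The product in the group of a word in the letters. -/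
def wordProd (w : List (Letter d m)) : FreeGp d m := (w.map Letter.val).prod

theorem wordProd_cons (l : Letter d m) (w : LetterWord d m) :
    wordProd (w.cons l).1 = l.val * wordProd w.1 := by
  obtain ⟨w, h⟩ := w
  cases w with
  | nil => simp [LetterWord.cons, wordProd]
  | cons x w =>
    by_cases hx : x = l.inv
    · simp only [LetterWord.cons, hx, wordProd, Letter.val_inv, dite_true, List.map_cons,
        List.prod_cons]
      exact (mul_inv_cancel_left l.val _).symm
    · simp [LetterWord.cons, hx, wordProd]

/-- Allows statements about the action to be checked on one letter at a time, with no separate case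
for inverses. -/
theorem closure_S : Submonoid.closure (S d m) = ⊤ := by
  rw [eq_top_iff]
  rintro g -
  have hS {g : FreeGp d m} (hg : g ∈ S d m) : g ∈ Submonoid.closure (S d m) :=
    Submonoid.subset_closure hg
  induction g using Monoid.Coprod.induction_on with
  | inl x =>
    induction x using FreeGroup.induction_on with
    | C1 => rw [map_one]; exact one_mem _
    | of i => exact hS (.inl ⟨i, rfl⟩)
    | inv_of i _ => 
      have h : (Monoid.Coprod.inl (FreeGroup.of i)⁻¹ : FreeGp d m) = (a i)⁻¹ :=
        eq_inv_of_mul_eq_one_left (a := (Monoid.Coprod.inl (FreeGroup.of i)⁻¹ : FreeGp d m)) (by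
          rw [a, ← map_mul, inv_mul_cancel, map_one])
      exact hS (.inr (.inl ⟨i, h⟩))
    | mul x y hx hy => rw [map_mul]; exact mul_mem hx hy
  | inr x =>
    induction x using Monoid.CoprodI.induction_on with
    | one => rw [map_one]; exact one_mem _
    | of j x =>
      have hx : x = 1 ∨ x = Multiplicative.ofAdd 1 := by
        revert x; decide
      rcases hx with rfl | rfl
      · rw [map_one, map_one]; exact one_mem _
      · exact hS (.inr (.inr ⟨j, rfl⟩))
    | mul x y hx hy => rw [map_mul]; exact mul_mem hx hy
  | mul x y hx hy => exact mul_mem hx hy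

/-- Applied to the empty word, this gives the existence of a reduced word for `g`. -/
theorem wordProd_wordAction (g : FreeGp d m) (w : LetterWord d m) :
    wordProd (wordAction d m g w).1 = g * wordProd w.1 := by
  have hg : g ∈ Submonoid.closure (S d m) := by rw [closure_S]; trivial
  induction hg using Submonoid.closure_induction generalizing w with
  | mem g hg =>
    rw [← range_val] at hg
    obtain ⟨l, rfl⟩ := hg
    rw [wordAction_val]
    exact wordProd_cons l w
  | one => simp
  | mul x y _ _ hx hy => rw [map_mul, Equiv.Perm.mul_apply, hx, hy, mul_assoc]

/-- Uniqueness of reduced words: when a reduced word is rebuilt from the empty one, no cancellation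
occurs, so the product determines the word. -/
theorem wordAction_wordProd (w : LetterWord d m) :
    wordAction d m (wordProd w.1) ⟨[], .nil⟩ = w := by
  obtain ⟨w, h⟩ := w
  induction w with
  | nil => simp [wordProd]
  | cons x w ih =>
    have hw := ih h.tail
    simp only [wordProd, List.map_cons, List.prod_cons, map_mul, Equiv.Perm.mul_apply] at hw ⊢
    rw [hw, wordAction_val]
    change LetterWord.cons x _ = _
    cases w with
    | nil => rfl
    | cons y w => simp [LetterWord.cons, (List.isChain_cons_cons.1 h).1]

theorem val_injective : Function.Injective (Letter.val : Letter d m → FreeGp d m) := by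
  intro x y h
  have hx := wordAction_wordProd (⟨[x], by simp⟩ : LetterWord d m)
  have hy := wordAction_wordProd (⟨[y], by simp⟩ : LetterWord d m)
  simp only [wordProd, List.map_cons, List.map_nil, h] at hx hy
  simpa using congrArg Subtype.val (hx.symm.trans hy)

theorem isReducedWord_map_val (w : List (Letter d m)) :
    IsReducedWord (w.map Letter.val) ↔ w.IsChain (fun x y => y ≠ x.inv) := by
  have h1 : ∀ g ∈ w.map (Letter.val : Letter d m → FreeGp d m), g ∈ S d m := by
    intro g hg
    obtain ⟨l, -, rfl⟩ := List.mem_map.1 hg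
    rw [← range_val]
    exact ⟨l, rfl⟩
  have h2 : ∀ x y : Letter d m, y.val ∈ Next x.val ↔ y ≠ x.inv := by
    intro x y
    have hy : y.val ∈ S d m := by rw [← range_val]; exact ⟨y, rfl⟩
    simp [Next, hy, ← Letter.val_inv, val_injective.eq_iff]
  rw [IsReducedWord, List.isChain_map, and_iff_right h1]
  simp only [h2]

theorem existsUnique_isReducedWord (g : FreeGp d m) :
    ∃! w : List (FreeGp d m), IsReducedWord w ∧ w.prod = g := by
  refine ⟨(wordAction d m g ⟨[], .nil⟩).1.map Letter.val,
    ⟨(isReducedWord_map_val _).2 (wordAction d m g ⟨[], .nil⟩).2, ?_⟩, ?_⟩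
  · simpa [wordProd] using wordProd_wordAction g ⟨[], .nil⟩
  · rintro w ⟨hw, rfl⟩
    have hw' : ∃ v : List (Letter d m), v.map Letter.val = w := by
      rw [← Set.mem_range, Set.range_list_map, range_val]
      exact hw.1
    obtain ⟨v, rfl⟩ := hw'
    have := wordAction_wordProd ⟨v, (isReducedWord_map_val v).1 hw⟩
    rw [wordProd] at this
    rw [this]

instance : Countable (FreeGp d m) :=
  Function.Surjective.countable (f := wordProd (d := d) (m := m)) fun g =>
    ⟨(wordAction d m g ⟨[], .nil⟩).1, by simpa [wordProd] using wordProd_wordAction g ⟨[], .nil⟩⟩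

end FreeGp

/-! ### Nearest-neighbor paths in a tree and their limits -/

namespace ReducedWord

variable {G : Type*} [Group G]

/-- Words in the letters of `S` in which no letter is followed by its inverse. -/
def IsReduced (S : Set G) (w : List G) : Prop :=
  (∀ g ∈ w, g ∈ S) ∧ w.IsChain (fun g h => h ∈ S \ {g⁻¹})

/-- A symmetric set `S` such that every element is the product of a unique reduced word in `S`:
the Cayley graph of `S` is a tree. -/
structure IsTreeBasis (S : Set G) : Prop where
  finite : S.Finite
  inv_mem : ∀ g ∈ S, g⁻¹ ∈ S
  existsUnique : ∀ g : G, ∃! w : List G, IsReduced S w ∧ w.prod = g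

/-- The sequence `x` converges to the infinite reduced word `ξ`. -/
def IsLimit (S : Set G) (x ξ : ℕ → G) : Prop :=
  ((∀ i, ξ i ∈ S) ∧ ∀ i, ξ (i + 1) ∈ S \ {(ξ i)⁻¹}) ∧
    ∀ k : ℕ, ∀ᶠ n in atTop,
      ∃ w : List G, IsReduced S w ∧ w.prod = x n ∧ (List.range k).map ξ <+: w

namespace IsTreeBasis

variable {S : Set G} (hS : IsTreeBasis S)
include hS

/-- The reduced word of a group element. -/
noncomputable def nf (g : G) : List G := (hS.existsUnique g).choose

theorem isReduced_nf (g : G) : IsReduced S (hS.nf g) := (hS.existsUnique g).choose_spec.1.1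

theorem prod_nf (g : G) : (hS.nf g).prod = g := (hS.existsUnique g).choose_spec.1.2

theorem nf_prod {w : List G} (hw : IsReduced S w) : hS.nf w.prod = w :=
  ((hS.existsUnique w.prod).choose_spec.2 w ⟨hw, rfl⟩).symm

theorem nf_eq {w : List G} {g : G} (hw : IsReduced S w) (h : w.prod = g) : hS.nf g = w := by
  rw [← h, hS.nf_prod hw]

theorem nf_injective : Function.Injective hS.nf := fun g h e => by
  rw [← hS.prod_nf g, e, hS.prod_nf]

theorem nf_one : hS.nf 1 = [] := hS.nf_eq ⟨by simp, .nil⟩ rfl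

theorem nf_of_mem {g : G} (hg : g ∈ S) : hS.nf g = [g] := hS.nf_eq ⟨by simpa, by simp⟩ (by simp)

theorem ne_one_of_mem {g : G} (hg : g ∈ S) : g ≠ 1 := by
  rintro rfl
  simpa [hS.nf_one] using hS.nf_of_mem hg

/-- A step to a neighbor adds or removes a letter at the end of the reduced word. -/
theorem nf_mul_of_mem (g : G) {s : G} (hs : s ∈ S) :
    hS.nf (g * s) = hS.nf g ++ [s] ∨ hS.nf g = hS.nf (g * s) ++ [s⁻¹] := by
  have hr := hS.isReduced_nf g
  have hp := hS.prod_nf g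
  rcases List.eq_nil_or_concat (hS.nf g) with h | ⟨w, t, h⟩
  · left
    rw [h] at hp
    rw [h, ← hp, List.prod_nil, one_mul, hS.nf_of_mem hs, List.nil_append]
  · rw [List.concat_eq_append] at h
    by_cases ht : t = s⁻¹
    · right
      subst ht
      rw [h] at hp hr
      have hw : IsReduced S w :=
        ⟨fun x hx => hr.1 x (by simp [hx]), (List.isChain_append.1 hr.2).1⟩
      rw [h, hS.nf_eq hw (by rw [← hp]; simp)]
    · left
      refine hS.nf_eq ⟨?_, ?_⟩ (by simp [hp])
      · intro x hx
        rcases List.mem_append.1 hx with hx | hx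
        · exact hr.1 x hx
        · rw [List.mem_singleton.1 hx]; exact hs
      · refine List.isChain_append.2 ⟨hr.2, by simp, ?_⟩
        intro x hx y hy
        rw [h] at hx
        simp only [List.getLast?_append, List.getLast?_singleton, Option.some_or, Option.mem_def,
          Option.some.injEq, List.head?_cons] at hx hy
        subst hx hy
        exact ⟨hs, fun e => ht (by rw [Set.mem_singleton_iff.1 e, inv_inv])⟩

/-- Left multiplication by `g` either prepends `g` or cancels a leading `g⁻¹`; after a cancellation
the first letter cannot be `g`, since the word was reduced. -/
theorem head?_nf_mul {g : G} (hg : g ∈ S) (x : G) :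
    (hS.nf (g * x)).head? = some g ↔ (hS.nf x).head? ≠ some g⁻¹ := by
  have hr := hS.isReduced_nf x
  have hp := hS.prod_nf x
  rcases h : hS.nf x with _ | ⟨t, w⟩
  · rw [h] at hp
    simp [← hp, hS.nf_of_mem hg]
  · rw [h] at hr hp
    by_cases ht : t = g⁻¹
    · subst ht
      have hw : IsReduced S w := ⟨fun y hy => hr.1 y (by simp [hy]), hr.2.tail⟩
      rw [hS.nf_eq hw (by rw [← hp]; simp)]
      simp only [List.head?_cons, ne_eq, not_true_eq_false, iff_false]
      intro hc
      cases w with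
      | nil => simp at hc
      | cons y w =>
        have := (List.isChain_cons_cons.1 hr.2).1.2
        simp_all
    · rw [hS.nf_eq (w := g :: t :: w) ⟨by simpa [hg] using hr.1, ?_⟩ (by simp [← hp])]
      · simp [ht]
      · exact List.isChain_cons_cons.2 ⟨⟨hr.1 t (by simp), ht⟩, hr.2⟩

section Path

variable {x : ℕ → G} (hx : ∀ n, (x n)⁻¹ * x (n + 1) ∈ S)
include hx

theorem nf_succ (n : ℕ) : (∃ s, hS.nf (x (n + 1)) = hS.nf (x n) ++ [s]) ∨
    ∃ s, hS.nf (x n) = hS.nf (x (n + 1)) ++ [s] := by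
  have := hS.nf_mul_of_mem (x n) (hx n)
  rw [mul_inv_cancel_left] at this
  exact this.imp (fun h => ⟨_, h⟩) (fun h => ⟨_, h⟩)

/-- A nearest neighbor path started at the identity that enters the cone of `g` visits `g`. -/
theorem exists_eq_of_head? (h0 : x 0 = 1) {g : G} {n : ℕ} (hn : (hS.nf (x n)).head? = some g) :
    ∃ k, x k = g := by
  induction n with
  | zero => simp [h0, hS.nf_one] at hn
  | succ n ih =>
    rcases hS.nf_succ hx n with ⟨s, hs⟩ | ⟨s, hs⟩
    · rcases h : hS.nf (x n) with _ | ⟨t, w⟩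
      · rw [hs, h] at hn
        have hg : s = g := by simpa using hn
        exact ⟨n + 1, by rw [← hS.prod_nf (x (n + 1)), hs, h]; simpa⟩
      · apply ih
        rw [hs, h] at hn
        rw [h]
        simpa using hn
    · apply ih
      rw [hs, List.head?_append, hn]
      rfl

variable (ht : ∀ g, ∀ᶠ n in atTop, x n ≠ g)
include ht

-- Finiteness of `S` makes balls finite, so a path that leaves every point for good leaves every
-- ball for good.
omit hx in
theorem eventually_lt_length (k : ℕ) : ∀ᶠ n in atTop, k < (hS.nf (x n)).length := by
  have hfin : {g : G | (hS.nf g).length ≤ k}.Finite := by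
    refine Set.Finite.of_injOn (t := {w : List G | w.length ≤ k ∧ ∀ g ∈ w, g ∈ S})
      (fun g hg => ⟨hg, (hS.isReduced_nf g).1⟩) hS.nf_injective.injOn ?_
    have : Finite S := hS.finite
    refine ((List.finite_length_le S k).image (List.map Subtype.val)).subset ?_
    rintro w ⟨hw, hwS⟩
    refine ⟨w.attachWith _ hwS, by simpa using hw, by simp⟩
  have := (hfin.eventually_all (l := atTop) (p := fun g n => x n ≠ g)).2 fun g _ => ht g
  filter_upwards [this] with n hn
  by_contra hc
  exact hn (x n) (not_lt.1 hc) rfl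

/-- Of two consecutive normal forms, the shorter is a prefix of the longer. Once both always have
length more than `k`, the letter at position `k` is frozen. -/
theorem exists_eventually_getElem? (k : ℕ) :
    ∃ s, ∀ᶠ n in atTop, (hS.nf (x n))[k]? = some s := by
  obtain ⟨N, hN⟩ := eventually_atTop.1 (hS.eventually_lt_length ht k)
  refine ⟨(hS.nf (x N))[k]'(hN N le_rfl), eventually_atTop.2 ⟨N, fun n hn => ?_⟩⟩
  induction n, hn using Nat.le_induction with
  | base => simp
  | succ n hn ih =>
    rw [← ih]
    rcases hS.nf_succ hx n with ⟨s, hs⟩ | ⟨s, hs⟩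
    · rw [hs, List.getElem?_append_left (hN n hn)]
    · rw [hs, List.getElem?_append_left (hN (n + 1) (by omega))]

omit hx ht in
theorem isLimit_prefix {ξ : ℕ → G} (h : IsLimit S x ξ) (k : ℕ) :
    ∀ᶠ n in atTop, (hS.nf (x n))[k]? = some (ξ k) := by
  filter_upwards [h.2 (k + 1)] with n hn
  obtain ⟨w, hw, hwx, hp⟩ := hn
  rw [hS.nf_eq hw hwx]
  obtain ⟨v, rfl⟩ := hp
  rw [List.getElem?_append_left (by simp)]
  simp

theorem existsUnique_isLimit : ∃! ξ, IsLimit S x ξ := by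
  choose ξ hξ using hS.exists_eventually_getElem? hx ht
  refine ⟨ξ, ⟨⟨fun i => ?_, fun i => ?_⟩, fun k => ?_⟩, fun ζ hζ => ?_⟩
  · obtain ⟨n, hn⟩ := (hξ i).exists
    exact (hS.isReduced_nf (x n)).1 _ (List.mem_of_getElem? hn)
  · obtain ⟨n, hn, hn'⟩ := ((hξ i).and (hξ (i + 1))).exists
    obtain ⟨h1, h2⟩ := List.getElem?_eq_some_iff.1 hn
    obtain ⟨h3, h4⟩ := List.getElem?_eq_some_iff.1 hn'
    have := List.isChain_iff_getElem.1 (hS.isReduced_nf (x n)).2 i h3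
    rwa [h2, h4] at this
  · have := (eventually_all_finset (Finset.range k)).2 fun i _ => hξ i
    filter_upwards [this] with n hn
    refine ⟨hS.nf (x n), hS.isReduced_nf _, hS.prod_nf _, ?_⟩
    rw [List.prefix_iff_getElem?]
    intro i hi
    simp only [List.length_map, List.length_range] at hi
    rw [hn i (by simpa using hi)]
    simp
  · funext k
    obtain ⟨n, hn, hn'⟩ := ((hξ k).and (hS.isLimit_prefix hζ k)).exists
    exact Option.some_injective _ (hn'.symm.trans hn)

/-- The first letter of the limit is the eventual first letter of the path. -/
theorem exists_isLimit_iff (g : G) : (∃ ξ, IsLimit S x ξ ∧ ξ 0 = g) ↔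
    ∀ᶠ n in atTop, (hS.nf (x n)).head? = some g := by
  obtain ⟨ξ, hξ, huniq⟩ := hS.existsUnique_isLimit hx ht
  have h0 := hS.isLimit_prefix hξ 0
  simp only [← List.head?_eq_getElem?] at h0
  constructor
  · rintro ⟨ζ, hζ, rfl⟩
    rwa [huniq ζ hζ]
  · intro h
    obtain ⟨n, hn, hn'⟩ := (h0.and h).exists
    exact ⟨ξ, hξ, Option.some_injective _ (hn.symm.trans hn')⟩

/-- Failure of "eventually `g⁻¹`" a priori means only "infinitely often not `g⁻¹`"; the
stabilization of the first letter turns it into "eventually not `g⁻¹`". -/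
theorem eventually_head?_mul {g : G} (hg : g ∈ S) :
    (∀ᶠ n in atTop, (hS.nf (g * x n)).head? = some g) ↔
      ¬ ∀ᶠ n in atTop, (hS.nf (x n)).head? = some g⁻¹ := by
  simp only [hS.head?_nf_mul hg]
  obtain ⟨s, hs⟩ := hS.exists_eventually_getElem? hx ht 0
  simp only [← List.head?_eq_getElem?] at hs
  constructor
  · intro h h'
    obtain ⟨n, hn, hn'⟩ := (h.and h').exists
    exact hn hn'
  · intro h
    have hne : s ≠ g⁻¹ := by
      rintro rfl
      exact h hs
    filter_upwards [hs] with n hn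
    rw [hn]
    simpa using hne

end Path

end IsTreeBasis

end ReducedWord

theorem FreeGp.isTreeBasis (d m : ℕ) : ReducedWord.IsTreeBasis (FreeGp.S d m) where
  finite := FreeGp.finite_S
  inv_mem _ := FreeGp.inv_mem_S
  existsUnique := FreeGp.existsUnique_isReducedWord

/-! ### Markov property for countable chains -/

/-- Under `P`, the process `X` is the Markov chain started at `x` with transition weights `K`. -/
structure IsMarkovChain {E Ω : Type*} [MeasurableSpace Ω] (K : E → E → ENNReal) (x : E)
    (P : Measure Ω) (X : ℕ → Ω → E) : Prop where
  isProbabilityMeasure : IsProbabilityMeasure P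
  measurable : ∀ n y, MeasurableSet {ω | X n ω = y}
  start : ∀ᵐ ω ∂P, X 0 ω = x
  markov : ∀ (n : ℕ) (z : ℕ → E),
    P {ω | ∀ k ≤ n + 1, X k ω = z k} = P {ω | ∀ k ≤ n, X k ω = z k} * K (z n) (z (n + 1))

namespace IsMarkovChain

variable {E Ω Ω' : Type*} [MeasurableSpace Ω] [MeasurableSpace Ω'] {K : E → E → ENNReal} {x₀ x : E}
  {P : Measure Ω} {X : ℕ → Ω → E} {P' : Measure Ω'} {X' : ℕ → Ω' → E}

theorem measurable_path [Countable E] [MeasurableSpace E] (h : IsMarkovChain K x₀ P X) :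
    Measurable (fun ω n => X n ω) :=
  measurable_pi_lambda _ fun n => measurable_to_countable' fun y => h.measurable n y

theorem measurableSet_cylinder (h : IsMarkovChain K x₀ P X) (n : ℕ) (z : ℕ → E) :
    MeasurableSet {ω | ∀ k ≤ n, X k ω = z k} := by
  have : {ω | ∀ k ≤ n, X k ω = z k} = ⋂ k, ⋂ (_ : k ≤ n), {ω | X k ω = z k} := by
    ext; simp
  rw [this]
  exact .iInter fun k => .iInter fun _ => h.measurable k _

/-- The sequence that starts with `z` and then is constant equal to `e`. -/
def extendPath {n : ℕ} (e : E) (z : Fin (n + 1) → E) (k : ℕ) : E :=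
  if hk : k < n + 1 then z ⟨k, hk⟩ else e

theorem extendPath_of_le {n : ℕ} (e : E) (z : Fin (n + 1) → E) {k : ℕ} (hk : k ≤ n) :
    extendPath e z k = z ⟨k, Nat.lt_succ_of_le hk⟩ :=
  dif_pos _

theorem extendPath_succ {n : ℕ} (e : E) (z : Fin (n + 1) → E) : extendPath e z (n + 1) = e :=
  dif_neg (lt_irrefl _)

theorem extendPath_restrict {n : ℕ} (e : E) (y : ℕ → E) {k : ℕ} (hk : k ≤ n) :
    extendPath e (fun i : Fin (n + 1) => y i) k = y k :=
  extendPath_of_le e _ hk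

/-- The Markov property at time `n`, conditionally on an event `B` that depends only on the path up
to time `n`. -/
theorem markov_past [Countable E] (h : IsMarkovChain K x₀ P X) {n : ℕ} {B : Set (ℕ → E)}
    (hB : ∀ y y' : ℕ → E, (∀ k ≤ n, y k = y' k) → y ∈ B → y' ∈ B) (x y : E) :
    P {ω | (fun k => X k ω) ∈ B ∧ X n ω = x ∧ X (n + 1) ω = y} =
      P {ω | (fun k => X k ω) ∈ B ∧ X n ω = x} * K x y := by
  -- The countably many histories up to time `n` that realize the event. Extending them by the
  -- constant `y` makes the same sequence also prescribe the state at time `n + 1`.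
  let I := {z : Fin (n + 1) → E // extendPath y z ∈ B ∧ extendPath y z n = x}
  have h1 : {ω | (fun k => X k ω) ∈ B ∧ X n ω = x} =
      ⋃ z : I, {ω | ∀ k ≤ n, X k ω = extendPath y z.1 k} := by
    ext ω
    simp only [Set.mem_ofPred_eq, Set.mem_iUnion]
    constructor
    · rintro ⟨h1, h2⟩
      refine ⟨⟨fun k => X k ω, ?_, ?_⟩, ?_⟩
      · exact hB _ _ (fun k hk => (extendPath_restrict y (fun k => X k ω) hk).symm) h1
      · rw [extendPath_restrict y (fun k => X k ω) le_rfl, h2]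
      · intro k hk
        exact (extendPath_restrict y (fun k => X k ω) hk).symm
    · rintro ⟨⟨z, hz, hz'⟩, h⟩
      exact ⟨hB _ _ (fun k hk => (h k hk).symm) hz, (h n le_rfl).trans hz'⟩
  have h2 : {ω | (fun k => X k ω) ∈ B ∧ X n ω = x ∧ X (n + 1) ω = y} =
      ⋃ z : I, {ω | ∀ k ≤ n + 1, X k ω = extendPath y z.1 k} := by
    have : {ω | (fun k => X k ω) ∈ B ∧ X n ω = x ∧ X (n + 1) ω = y} =
      {ω | (fun k => X k ω) ∈ B ∧ X n ω = x} ∩ {ω | X (n + 1) ω = y} := by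
      ext; simp [and_assoc]
    rw [this, h1, Set.iUnion_inter]
    congr 1
    funext z
    ext ω
    simp only [Set.mem_inter_iff, Set.mem_ofPred_eq]
    constructor
    · rintro ⟨ha, hb⟩ k hk
      rcases Nat.le_succ_iff.1 hk with hk | rfl
      · exact ha k hk
      · rw [hb]; exact (extendPath_succ _ _).symm
    · intro ha
      exact ⟨fun k hk => ha k (by omega), (ha (n + 1) le_rfl).trans (extendPath_succ _ _)⟩
  have hdisj (z z' : I) (hz : z ≠ z') :
      Disjoint {ω | ∀ k ≤ n, X k ω = extendPath y z.1 k} {ω | ∀ k ≤ n, X k ω = extendPath y z'.1 k} := by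
    rw [Set.disjoint_left]
    intro ω h h'
    apply hz
    ext k
    have := (h k (by omega)).symm.trans (h' k (by omega))
    rwa [extendPath_of_le _ _ (by omega), extendPath_of_le _ _ (by omega)] at this
  have hdisj' (z z' : I) (hz : z ≠ z') :
      Disjoint {ω | ∀ k ≤ n + 1, X k ω = extendPath y z.1 k}
        {ω | ∀ k ≤ n + 1, X k ω = extendPath y z'.1 k} :=
    (hdisj z z' hz).mono (fun ω hω k hk => hω k (Nat.le_succ_of_le hk))
      (fun ω hω k hk => hω k (Nat.le_succ_of_le hk))
  rw [h1, h2, measure_iUnion (fun z z' hz => hdisj z z' hz)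
    (fun z => h.measurableSet_cylinder n _), measure_iUnion (fun z z' hz => hdisj' z z' hz)
    (fun z => h.measurableSet_cylinder (n + 1) _), ← ENNReal.tsum_mul_right]
  congr 1
  funext z
  rw [h.markov, z.2.2, extendPath_succ]

theorem measure_start (h : IsMarkovChain K x₀ P X) (y : E) :
    P {ω | X 0 ω = y} = ({x₀} : Set E).indicator 1 y := by
  have := h.isProbabilityMeasure
  by_cases hy : y = x₀
  · subst hy
    simpa using (mem_ae_iff_prob_eq_one (h.measurable 0 y)).1 h.start
  · rw [Set.indicator_of_notMem (by simpa using hy), measure_eq_zero_iff_ae_notMem]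
    filter_upwards [h.start] with ω hω hω'
    exact hy (Eq.trans (Eq.symm hω') hω)

/-- The finite dimensional form of the Markov property. -/
theorem markov_cylinder [Countable E] (h : IsMarkovChain K x₀ P X) (h' : IsMarkovChain K x P' X')
    {n : ℕ} {B : Set (ℕ → E)} (hB : ∀ y y' : ℕ → E, (∀ k ≤ n, y k = y' k) → y ∈ B → y' ∈ B)
    (N : ℕ) (w : ℕ → E) :
    P {ω | (fun k => X k ω) ∈ B ∧ X n ω = x ∧ ∀ k ≤ N, X (n + k) ω = w k} =
      P {ω | (fun k => X k ω) ∈ B ∧ X n ω = x} * P' {ω | ∀ k ≤ N, X' k ω = w k} := by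
  induction N with
  | zero =>
    simp only [Nat.le_zero, forall_eq, add_zero, h'.measure_start]
    by_cases hw : x = w 0
    · simp [← hw]
    · have hw' : w 0 ∉ ({x} : Set E) := fun e => hw (Set.mem_singleton_iff.1 e).symm
      have : ∀ ω, ¬ (X n ω = x ∧ X n ω = w 0) := fun ω hω => hw (hω.1.symm.trans hω.2)
      simp [Set.indicator_of_notMem hw', this]
  | succ N ih =>
    rw [h'.markov, ← mul_assoc, ← ih]
    -- The prescribed states at times `n, ..., n + N` are absorbed into the past event, which leaves
    -- a single step from `w N` to `w (N + 1)`.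
    have := h.markov_past (n := n + N) (B := {y | y ∈ B ∧ y n = x ∧ ∀ k ≤ N, y (n + k) = w k})
      (fun y y' hy hyB => ⟨hB y y' (fun k hk => hy k (by omega)) hyB.1,
        (hy n (by omega)) ▸ hyB.2.1, fun k hk => (hy (n + k) (by omega)) ▸ hyB.2.2 k hk⟩)
      (w N) (w (N + 1))
    convert this using 2
    · congr 1
      ext ω
      simp only [Set.mem_ofPred_eq]
      constructor
      · rintro ⟨h1, h2, h3⟩
        exact ⟨⟨h1, h2, fun k hk => h3 k (by omega)⟩, h3 N (by omega), h3 (N + 1) le_rfl⟩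
      · rintro ⟨⟨h1, h2, h3⟩, h4, h5⟩
        refine ⟨h1, h2, fun k hk => ?_⟩
        rcases Nat.le_succ_iff.1 hk with hk | rfl
        · exact h3 k hk
        · exact h5
    · congr 1
      ext ω
      simp only [Set.mem_ofPred_eq]
      exact ⟨fun hω => ⟨hω, hω.2.2 N le_rfl⟩, fun hω => hω.1⟩

/-- Two cylinders with a common path `y` meet in the cylinder of `y` of the greater length. -/
theorem isPiSystem_cylinder :
    IsPiSystem (Set.range fun p : ℕ × (ℕ → E) => {y : ℕ → E | ∀ k ≤ p.1, y k = p.2 k}) := by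
  rintro _ ⟨⟨n, z⟩, rfl⟩ _ ⟨⟨n', z'⟩, rfl⟩ ⟨y, hy, hy'⟩
  refine ⟨⟨max n n', y⟩, ?_⟩
  ext t
  simp only [Set.mem_ofPred_eq, Set.mem_inter_iff] at hy hy' ⊢
  constructor
  · intro ht
    exact ⟨fun k hk => (ht k (by omega)).trans (hy k hk),
      fun k hk => (ht k (by omega)).trans (hy' k hk)⟩
  · rintro ⟨h1, h2⟩ k hk
    rcases le_max_iff.1 hk with hk | hk
    · exact (h1 k hk).trans (hy k hk).symm
    · exact (h2 k hk).trans (hy' k hk).symm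

theorem generateFrom_cylinder [Countable E] [MeasurableSpace E] [DiscreteMeasurableSpace E] :
    (MeasurableSpace.pi : MeasurableSpace (ℕ → E)) = MeasurableSpace.generateFrom
      (Set.range fun p : ℕ × (ℕ → E) => {y : ℕ → E | ∀ k ≤ p.1, y k = p.2 k}) := by
  apply le_antisymm
  · refine iSup_le fun n => ?_
    rintro _ ⟨s, -, rfl⟩
    rcases isEmpty_or_nonempty E with hE | ⟨⟨e⟩⟩
    · convert MeasurableSet.empty
      ext y
      exact hE.elim (y 0)
    have : Function.eval n ⁻¹' s =
        ⋃ z : {z : Fin (n + 1) → E // extendPath e z n ∈ s}, {y | ∀ k ≤ n, y k = extendPath e z.1 k} := by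
      ext y
      simp only [Set.mem_preimage, Function.eval, Set.mem_iUnion, Set.mem_ofPred_eq]
      constructor
      · intro hy
        refine ⟨⟨fun k => y k, ?_⟩, fun k hk => (extendPath_restrict e y hk).symm⟩
        rwa [extendPath_restrict e y le_rfl]
      · rintro ⟨z, hz⟩
        rw [hz n le_rfl]
        exact z.2
    rw [this]
    refine @MeasurableSet.iUnion _ _ (MeasurableSpace.generateFrom _) _ _ fun z => ?_
    exact MeasurableSpace.measurableSet_generateFrom ⟨⟨n, extendPath e z.1⟩, rfl⟩
  · refine MeasurableSpace.generateFrom_le ?_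
    rintro _ ⟨⟨n, z⟩, rfl⟩
    have : {y : ℕ → E | ∀ k ≤ n, y k = z k} = ⋂ k, ⋂ (_ : k ≤ n), Function.eval k ⁻¹' {z k} := by
      ext; simp
    change MeasurableSet {y : ℕ → E | ∀ k ≤ n, y k = z k}
    rw [this]
    exact .iInter fun k => .iInter fun _ => measurable_pi_apply k (.of_discrete)

/-- The Markov property at time `n`. -/
theorem markov_shift [Countable E] [MeasurableSpace E] [DiscreteMeasurableSpace E]
    (h : IsMarkovChain K x₀ P X) (h' : IsMarkovChain K x P' X')
    {n : ℕ} {B : Set (ℕ → E)} (hBm : MeasurableSet B)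
    (hB : ∀ y y' : ℕ → E, (∀ k ≤ n, y k = y' k) → y ∈ B → y' ∈ B)
    {A : Set (ℕ → E)} (hA : MeasurableSet A) :
    P {ω | (fun k => X k ω) ∈ B ∧ X n ω = x ∧ (fun k => X (n + k) ω) ∈ A} =
      P {ω | (fun k => X k ω) ∈ B ∧ X n ω = x} * P' {ω | (fun k => X' k ω) ∈ A} := by
  have := h.isProbabilityMeasure
  have := h'.isProbabilityMeasure
  set D : Set Ω := {ω | (fun k => X k ω) ∈ B ∧ X n ω = x} with hD
  have hDm : MeasurableSet D := (h.measurable_path hBm).inter (h.measurable n x)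
  have hm : Measurable (fun ω k => X (n + k) ω) :=
    measurable_pi_lambda _ fun k => measurable_to_countable' fun y => h.measurable (n + k) y
  have key {A : Set (ℕ → E)} (hA : MeasurableSet A) : ((P.restrict D).map fun ω k => X (n + k) ω) A =
      P {ω | (fun k => X k ω) ∈ B ∧ X n ω = x ∧ (fun k => X (n + k) ω) ∈ A} := by
    rw [Measure.map_apply hm hA, Measure.restrict_apply (hm hA)]
    congr 1
    ext ω
    simp only [hD, Set.mem_inter_iff, Set.mem_preimage, Set.mem_ofPred_eq]
    tauto
  -- Both sides are finite measures on path space with the same total mass that agree on the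
  -- π-system of cylinders.
  have hmeas : (P.restrict D).map (fun ω k => X (n + k) ω) =
      (P D) • P'.map (fun ω k => X' k ω) := by
    refine ext_of_generate_finite _ generateFrom_cylinder isPiSystem_cylinder ?_ ?_
    · rintro _ ⟨⟨N, w⟩, rfl⟩
      have hc : MeasurableSet {y : ℕ → E | ∀ k ≤ N, y k = w k} := by
        rw [generateFrom_cylinder]
        exact MeasurableSpace.measurableSet_generateFrom ⟨⟨N, w⟩, rfl⟩
      rw [key hc, Measure.smul_apply, Measure.map_apply h'.measurable_path hc, smul_eq_mul]
      exact h.markov_cylinder h' hB N w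
    · rw [Measure.map_apply hm .univ, Measure.smul_apply,
        Measure.map_apply h'.measurable_path .univ]
      simp
  rw [← key hA, hmeas, Measure.smul_apply, Measure.map_apply h'.measurable_path hA, smul_eq_mul]
  rfl

/-- The strong Markov property at the first visit to `H`. -/
theorem markov_hit [Countable E] [MeasurableSpace E] [DiscreteMeasurableSpace E]
    (h : IsMarkovChain K x₀ P X) (h' : IsMarkovChain K x P' X') (H : Set E) (hx : x ∈ H)
    {A : Set (ℕ → E)} (hA : MeasurableSet A) :
    P {ω | ∃ n, (∀ k < n, X k ω ∉ H) ∧ X n ω = x ∧ (fun k => X (n + k) ω) ∈ A} =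
      P {ω | ∃ n, (∀ k < n, X k ω ∉ H) ∧ X n ω = x} * P' {ω | (fun k => X' k ω) ∈ A} := by
  have hBm (n : ℕ) : MeasurableSet {y : ℕ → E | ∀ k < n, y k ∉ H} := by
    have : {y : ℕ → E | ∀ k < n, y k ∉ H} = ⋂ k, ⋂ (_ : k < n), Function.eval k ⁻¹' Hᶜ := by
      ext; simp
    rw [this]
    exact .iInter fun k => .iInter fun _ => measurable_pi_apply k (.of_discrete)
  have hD (n : ℕ) : MeasurableSet {ω | (∀ k < n, X k ω ∉ H) ∧ X n ω = x} :=
    (h.measurable_path (hBm n)).inter (h.measurable n x)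
  have hm (n : ℕ) : Measurable (fun ω k => X (n + k) ω) :=
    measurable_pi_lambda _ fun k => measurable_to_countable' fun y => h.measurable (n + k) y
  -- Since `x ∈ H`, the time of the first visit to `H` is unique.
  have hdisj : Pairwise (Function.onFun Disjoint
      fun n => {ω | (∀ k < n, X k ω ∉ H) ∧ X n ω = x}) := by
    intro n n' hn
    rw [Function.onFun, Set.disjoint_left]
    rintro ω ⟨h1, h2⟩ ⟨h3, h4⟩
    rcases lt_or_gt_of_ne hn with hn | hn
    · exact h3 n hn (h2 ▸ hx)
    · exact h1 n' hn (h4 ▸ hx)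
  have e1 : {ω | ∃ n, (∀ k < n, X k ω ∉ H) ∧ X n ω = x} =
      ⋃ n, {ω | (∀ k < n, X k ω ∉ H) ∧ X n ω = x} := Set.ofPred_exists _
  have e2 : {ω | ∃ n, (∀ k < n, X k ω ∉ H) ∧ X n ω = x ∧ (fun k => X (n + k) ω) ∈ A} =
      ⋃ n, {ω | (∀ k < n, X k ω ∉ H) ∧ X n ω = x ∧ (fun k => X (n + k) ω) ∈ A} :=
    Set.ofPred_exists _
  rw [e1, e2, measure_iUnion hdisj hD, measure_iUnion, ← ENNReal.tsum_mul_right]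
  · congr 1
    funext n
    exact h.markov_shift h' (hBm n) (B := {y | ∀ k < n, y k ∉ H})
      (fun y y' hy hyB k hk => hy k hk.le ▸ hyB k hk) hA
  · intro n n' hn
    refine Disjoint.mono ?_ ?_ (hdisj hn) <;> exact fun ω hω => ⟨hω.1, hω.2.1⟩
  · intro n
    convert (hD n).inter (hm n hA) using 1
    ext ω
    simp [and_assoc]

end IsMarkovChain

/-! ### An invertibility criterion -/

/-- If $Mx=x$, then $|x|\le M|x|$, and induction on $k$ gives $|x|\le C f_k$ with $C=\sum_j|x_j|$.
The limit forces $x=0$, so $I-M$ is injective. -/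
theorem Matrix.isUnit_one_sub_of_tendsto_zero {n : Type*} [Fintype n] [DecidableEq n]
    {M : Matrix n n ℝ} (hM : ∀ i j, 0 ≤ M i j) {f : ℕ → n → ℝ} (h0 : ∀ i, 1 ≤ f 0 i)
    (hf : ∀ k i, ∑ j, M i j * f k j ≤ f (k + 1) i)
    (hlim : ∀ i, Tendsto (fun k => f k i) atTop (nhds 0)) : IsUnit (1 - M) := by
  rw [← Matrix.mulVec_injective_iff_isUnit]
  refine (injective_iff_map_eq_zero (Matrix.mulVecLin (1 - M))).2 fun x hx => ?_
  have hx' : M.mulVec x = x := by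
    rw [Matrix.mulVecLin_apply, Matrix.sub_mulVec, Matrix.one_mulVec, sub_eq_zero] at hx
    exact hx.symm
  have hc : 0 ≤ ∑ j, |x j| := Finset.sum_nonneg fun j _ => abs_nonneg _
  have hbound (k : ℕ) : ∀ i, |x i| ≤ (∑ j, |x j|) * f k i := by
    induction k with
    | zero =>
      intro i
      calc |x i| ≤ ∑ j, |x j| :=
            Finset.single_le_sum (f := fun j => |x j|) (fun j _ => abs_nonneg _) (Finset.mem_univ i)
        _ ≤ (∑ j, |x j|) * f 0 i := le_mul_of_one_le_right hc (h0 i)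
    | succ k ih =>
      intro i
      calc |x i| = |∑ j, M i j * x j| := by
            conv_lhs => rw [← hx']
            rfl
        _ ≤ ∑ j, |M i j * x j| := Finset.abs_sum_le_sum_abs _ _
        _ ≤ ∑ j, M i j * ((∑ j, |x j|) * f k j) := by
            refine Finset.sum_le_sum fun j _ => ?_
            rw [abs_mul, abs_of_nonneg (hM i j)]
            exact mul_le_mul_of_nonneg_left (ih j) (hM i j)
        _ = (∑ j, |x j|) * ∑ j, M i j * f k j := by
            rw [Finset.mul_sum]
            exact Finset.sum_congr rfl fun j _ => by ring
        _ ≤ (∑ j, |x j|) * f (k + 1) i := mul_le_mul_of_nonneg_left (hf k i) hc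
  funext i
  have : |x i| ≤ 0 := by
    refine ge_of_tendsto' (x := atTop) (f := fun k => (∑ j, |x j|) * f k i) ?_ fun k => hbound k i
    simpa using (hlim i).const_mul (∑ j, |x j|)
  exact abs_nonpos_iff.1 this

/-! ### Hitting times -/

namespace ColoredWalk

section HittingTime

variable {G Ω : Type*} {r : ℕ} (X : ℕ → Ω → G × Fin r)

theorem hitTime_eq_coe_iff (A : Set (G × Fin r)) (ω : Ω) (n : ℕ) :
    hitTime X A ω = n ↔ (∀ k < n, X k ω ∉ A) ∧ X n ω ∈ A := by
  have hle (k : ℕ) (hk : X k ω ∈ A) : hitTime X A ω ≤ k := sInf_le ⟨k, hk, rfl⟩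
  constructor
  · intro h
    have hne : ((fun n : ℕ => (n : ℕ∞)) '' {n | X n ω ∈ A}).Nonempty := by
      by_contra hc
      rw [Set.not_nonempty_iff_eq_empty] at hc
      simp [hitTime, hc] at h
    obtain ⟨k, hk, hk'⟩ := csInf_mem hne
    have hkn : k = n := by
      rw [← ENat.natCast_inj]
      exact hk'.trans h
    refine ⟨fun j hj hjA => ?_, hkn ▸ hk⟩
    have := hle j hjA
    rw [h, Nat.cast_le] at this
    omega
  · rintro ⟨h1, h2⟩
    refine le_antisymm (hle n h2) (le_sInf ?_)
    rintro _ ⟨k, hk, rfl⟩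
    rw [Nat.cast_le]
    by_contra hc
    exact h1 k (not_le.1 hc) hk

/-- The event that `g` is visited, for the first time with color `v`. -/
def hitSet (g : G) (v : Fin r) : Set Ω :=
  {ω | ∃ n, (∀ k < n, X k ω ∉ {x : G × Fin r | x.1 = g}) ∧ X n ω = (g, v)}

theorem exists_tau_eq_iff (g : G) (v : Fin r) (ω : Ω) :
    (∃ n : ℕ, tau X g ω = n ∧ X n ω = (g, v)) ↔ ω ∈ hitSet X g v := by
  simp only [tau, hitTime_eq_coe_iff, hitSet, Set.mem_ofPred_eq]
  refine exists_congr fun n => ⟨fun h => ⟨h.1.1, h.2⟩, fun h => ⟨⟨h.1, ?_⟩, h.2⟩⟩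
  rw [h.2]

theorem tau_eq_hitTime_iff (g : G) (v : Fin r) (ω : Ω) :
    (tau X g ω < ⊤ ∧ tau X g ω = hitTime X {(g, v)} ω) ↔ ω ∈ hitSet X g v := by
  rw [← exists_tau_eq_iff]
  constructor
  · rintro ⟨h1, h2⟩
    obtain ⟨n, hn⟩ := ENat.ne_top_iff_exists.1 h1.ne
    refine ⟨n, hn.symm, ?_⟩
    rw [← hn, eq_comm, hitTime_eq_coe_iff] at h2
    exact h2.2
  · rintro ⟨n, h1, h2⟩
    refine ⟨h1 ▸ ENat.natCast_lt_top n, ?_⟩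
    rw [h1, eq_comm, hitTime_eq_coe_iff]
    refine ⟨fun k hk hkx => ((hitTime_eq_coe_iff _ _ _ _).1 h1).1 k hk ?_, h2⟩
    rw [Set.mem_singleton_iff.1 hkx]
    rfl

theorem q_apply [MeasurableSpace Ω] (ℙ : Fin r → Measure Ω) (g : G) (u v : Fin r) :
    q ℙ X g u v = (ℙ u).real (hitSet X g v) := by
  simp only [q, tau_eq_hitTime_iff]
  rfl

theorem disjoint_hitSet (g : G) {v w : Fin r} (h : v ≠ w) :
    Disjoint (hitSet X g v) (hitSet X g w) := by
  rw [Set.disjoint_left]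
  rintro ω ⟨n, h1, h2⟩ ⟨k, h3, h4⟩
  rcases lt_trichotomy n k with hnk | rfl | hnk
  · exact h3 n hnk (by rw [h2]; rfl)
  · exact h (by simpa using h2.symm.trans h4)
  · exact h1 k hnk (by rw [h4]; rfl)

theorem exists_mem_hitSet {g : G} {ω : Ω} {n : ℕ} (h : (X n ω).1 = g) :
    ∃ v, ω ∈ hitSet X g v := by
  classical
  have hex : ∃ n, (X n ω).1 = g := ⟨n, h⟩
  refine ⟨(X (Nat.find hex) ω).2, Nat.find hex, fun k hk => Nat.find_min hex hk, ?_⟩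
  exact Prod.ext (Nat.find_spec hex) rfl

end HittingTime

/-! ### The colored walk: Markov property and transience -/

section Walk

variable {G : Type*} [Group G] {r : ℕ} {Ω : Type*} [MeasurableSpace Ω]
  {p : G → Matrix (Fin r) (Fin r) ℝ} {ℙ : Fin r → Measure Ω} {X : ℕ → Ω → G × Fin r}

/-- The transition probabilities of the colored walk. -/
noncomputable def kernel (p : G → Matrix (Fin r) (Fin r) ℝ) (x y : G × Fin r) : ENNReal :=
  ENNReal.ofReal (p (x.1⁻¹ * y.1) x.2 y.2)

/-- The translate by `g` of the walk started at `(1, v)` is the walk started at `(g, v)`. -/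
theorem isMarkovChain_translate {v : Fin r} (hX : IsColoredWalk p v (ℙ v) X) (g : G) :
    IsMarkovChain (kernel p) (g, v) (ℙ v) (fun n ω => (g * (X n ω).1, (X n ω).2)) := by
  have := hX.isProbabilityMeasure
  have heq (x y : G × Fin r) : (g * x.1, x.2) = y ↔ x = (g⁻¹ * y.1, y.2) := by
    rw [Prod.ext_iff, Prod.ext_iff, eq_inv_mul_iff_mul_eq]
  refine ⟨this, fun n y => ?_, ?_, fun n z => ?_⟩
  · simp only [heq]
    exact hX.measurable n _
  · filter_upwards [hX.start] with ω hω
    simp [hω]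
  · simp only [heq]
    have := hX.markov n fun k => (g⁻¹ * (z k).1, (z k).2)
    rw [← ofReal_measureReal, this, ENNReal.ofReal_mul measureReal_nonneg, ofReal_measureReal,
      kernel]
    simp [mul_assoc]

theorem isMarkovChain {v : Fin r} (hX : IsColoredWalk p v (ℙ v) X) :
    IsMarkovChain (kernel p) (1, v) (ℙ v) X := by
  simpa using isMarkovChain_translate hX 1

-- There are finitely many colors, so leaving each state for good means leaving each group element
-- for good.
omit [Group G] in
theorem ae_transient (htr : IsTransient ℙ X) [Countable G] (u : Fin r) :
    ∀ᵐ ω ∂ℙ u, ∀ g, ∀ᶠ n in atTop, (X n ω).1 ≠ g := by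
  rw [ae_all_iff]
  intro g
  filter_upwards [ae_all_iff.2 fun v => htr u (g, v)] with ω hω
  filter_upwards [eventually_all.2 hω] with n hn h
  exact hn (X n ω).2 (Prod.ext h rfl)

variable [Countable G]

theorem ae_step {S : Set G} (hnn : ∀ g, g ∉ S → p g = 0) {u : Fin r}
    (hX : IsColoredWalk p u (ℙ u) X) :
    ∀ᵐ ω ∂ℙ u, ∀ n, (X n ω).1⁻¹ * (X (n + 1) ω).1 ∈ S := by
  rw [ae_all_iff]
  intro n
  have key (x y : G × Fin r) (hxy : x.1⁻¹ * y.1 ∉ S) :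
      ∀ᵐ ω ∂ℙ u, ¬ (X n ω = x ∧ X (n + 1) ω = y) := by
    have := (isMarkovChain hX).markov_past (n := n) (B := Set.univ) (fun _ _ _ h => h) x y
    rw [kernel, hnn _ hxy] at this
    rw [ae_iff]
    simpa using this
  have key' : ∀ᵐ ω ∂ℙ u, ∀ x y : G × Fin r, x.1⁻¹ * y.1 ∉ S → ¬ (X n ω = x ∧ X (n + 1) ω = y) := by
    refine ae_all_iff.2 fun x => ae_all_iff.2 fun y => ?_
    by_cases hxy : x.1⁻¹ * y.1 ∈ S
    · exact Eventually.of_forall fun ω h => absurd hxy h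
    · filter_upwards [key x y hxy] with ω hω _
      exact hω
  filter_upwards [key'] with ω hω
  by_contra hc
  exact hω _ _ hc ⟨rfl, rfl⟩

variable [MeasurableSpace G] [DiscreteMeasurableSpace G]

/-- The event that the walk visits `g`, for the first time with color `v`, and that after this visit
its trajectory belongs to `A`. -/
def hitThen (X : ℕ → Ω → G × Fin r) (g : G) (v : Fin r) (A : Set (ℕ → G × Fin r)) : Set Ω :=
  {ω | ∃ n, (∀ k < n, X k ω ∉ {x : G × Fin r | x.1 = g}) ∧ X n ω = (g, v) ∧
    (fun k => X (n + k) ω) ∈ A}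

omit [Group G] [Countable G] [MeasurableSpace G] [DiscreteMeasurableSpace G]
  [MeasurableSpace Ω] in
theorem hitThen_subset (X : ℕ → Ω → G × Fin r) (g : G) (v : Fin r) (A : Set (ℕ → G × Fin r)) :
    hitThen X g v A ⊆ hitSet X g v :=
  fun _ ⟨n, h1, h2, _⟩ => ⟨n, h1, h2⟩

theorem measurableSet_hitThen {u : Fin r} (hX : IsColoredWalk p u (ℙ u) X) (g : G) (v : Fin r)
    {A : Set (ℕ → G × Fin r)} (hA : MeasurableSet A) : MeasurableSet (hitThen X g v A) := by
  have hm (n : ℕ) : Measurable (X n) := measurable_to_countable' fun y => hX.measurable n y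
  have : hitThen X g v A = ⋃ n, ((⋂ k, ⋂ (_ : k < n), X k ⁻¹' {x : G × Fin r | x.1 = g}ᶜ) ∩
      (X n ⁻¹' {(g, v)} ∩ (fun ω k => X (n + k) ω) ⁻¹' A)) := by
    ext ω
    simp [hitThen]
  rw [this]
  exact .iUnion fun n => (MeasurableSet.iInter fun k => .iInter fun _ => hm k .of_discrete).inter
    ((hm n .of_discrete).inter (measurable_pi_lambda _ (fun k => hm (n + k)) hA))

theorem measurableSet_hitSet {u : Fin r} (hX : IsColoredWalk p u (ℙ u) X) (g : G) (v : Fin r) :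
    MeasurableSet (hitSet X g v) := by
  simpa [hitThen, hitSet] using measurableSet_hitThen hX g v .univ

theorem measureReal_hitThen (hX : ∀ u, IsColoredWalk p u (ℙ u) X) (g : G) (u v : Fin r)
    {A : Set (ℕ → G × Fin r)} (hA : MeasurableSet A) :
    (ℙ u).real (hitThen X g v A) =
      q ℙ X g u v * (ℙ v).real {ω | (fun k => (g * (X k ω).1, (X k ω).2)) ∈ A} := by
  rw [q_apply, measureReal_def, measureReal_def, measureReal_def, ← ENNReal.toReal_mul]
  congr 1
  exact (isMarkovChain (hX u)).markov_hit (isMarkovChain_translate (hX v) g)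
    {x : G × Fin r | x.1 = g} rfl hA

/-- Visits to `g'` after time `k + 1` are at least as likely as visits to `g'` at least `k` units of
time after the first visit to `g`. -/
theorem sum_q_mul_le (hX : ∀ u, IsColoredWalk p u (ℙ u) X) {g : G} (hg : g ≠ 1) (g' : G) (k : ℕ)
    (u : Fin r) :
    ∑ v, q ℙ X g u v * (ℙ v).real {ω | ∃ n ≥ k, g * (X n ω).1 = g'} ≤
      (ℙ u).real {ω | ∃ n ≥ k + 1, (X n ω).1 = g'} := by
  have := (hX u).isProbabilityMeasure
  let A : Set (ℕ → G × Fin r) := {y | ∃ n ≥ k, (y n).1 = g'}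
  have hA : MeasurableSet A := by
    have : A = ⋃ n, ⋃ (_ : n ≥ k), Function.eval n ⁻¹' {x : G × Fin r | x.1 = g'} := by
      ext; simp [A]
    rw [this]
    exact .iUnion fun n => .iUnion fun _ => measurable_pi_apply n .of_discrete
  have h1 (v : Fin r) : q ℙ X g u v * (ℙ v).real {ω | ∃ n ≥ k, g * (X n ω).1 = g'} =
      (ℙ u).real (hitThen X g v A) := (measureReal_hitThen hX g u v hA).symm
  simp only [h1]
  rw [← measureReal_biUnion_finset (fun v _ w _ hvw => (disjoint_hitSet X g hvw).mono
    (hitThen_subset X g v A) (hitThen_subset X g w A))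
    (fun v _ => measurableSet_hitThen (hX u) g v hA)]
  refine ENNReal.toReal_mono (measure_ne_top _ _) (measure_mono_ae ?_)
  filter_upwards [(hX u).start] with ω h0 hω
  obtain ⟨v, -, n, hn, hnv, j, hj, hjg⟩ := Set.mem_iUnion₂.1 hω
  refine ⟨n + j, ?_, hjg⟩
  -- The walk starts at `1 ≠ g`, so reaching `g` takes at least one step; this is the gain from `k`
  -- to `k + 1`.
  have : n ≠ 0 := by
    rintro rfl
    rw [h0] at hnv
    exact hg (congrArg Prod.fst hnv).symm
  omega

theorem tendsto_measureReal_visit (hX : ∀ u, IsColoredWalk p u (ℙ u) X) (htr : IsTransient ℙ X)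
    (g : G) (u : Fin r) :
    Tendsto (fun k => (ℙ u).real {ω | ∃ n ≥ k, (X n ω).1 = g}) atTop (nhds 0) := by
  have := (hX u).isProbabilityMeasure
  have hm (k : ℕ) : MeasurableSet {ω | ∃ n ≥ k, (X n ω).1 = g} := by
    have : {ω | ∃ n ≥ k, (X n ω).1 = g} = ⋃ n, ⋃ (_ : n ≥ k), X n ⁻¹' {x : G × Fin r | x.1 = g} := by
      ext; simp
    rw [this]
    exact .iUnion fun n => .iUnion fun _ =>
      measurable_to_countable' (fun y => (hX u).measurable n y) .of_discrete
  have hzero : (ℙ u) (⋂ k, {ω | ∃ n ≥ k, (X n ω).1 = g}) = 0 := by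
    rw [measure_eq_zero_iff_ae_notMem]
    filter_upwards [ae_transient htr u] with ω hω hmem
    obtain ⟨k, hk⟩ := eventually_atTop.1 (hω g)
    obtain ⟨n, hn, hng⟩ := Set.mem_iInter.1 hmem k
    exact hk n hn hng
  have hlim := tendsto_measure_iInter_atTop (μ := ℙ u) (fun k => (hm k).nullMeasurableSet)
    (fun k l hkl ω ⟨n, hn, hng⟩ => ⟨n, le_trans hkl hn, hng⟩) ⟨0, measure_ne_top _ _⟩
  rw [hzero] at hlim
  exact (ENNReal.tendsto_toReal ENNReal.zero_ne_top).comp hlim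

/-- The dominating sequence is the probability of a visit to the identity at some time at least `2 *
k`. It is 1 for `k = 0`, and a trip to `g⁻¹` followed by a displacement by `g` costs at least two
steps, which advances `k` by one. -/
theorem isUnit_one_sub_q_mul_q (hX : ∀ u, IsColoredWalk p u (ℙ u) X) (htr : IsTransient ℙ X)
    {g : G} (hg : g ≠ 1) : IsUnit (1 - q ℙ X g⁻¹ * q ℙ X g) := by
  have hq (g : G) (u v : Fin r) : 0 ≤ q ℙ X g u v := by
    rw [q_apply]; exact measureReal_nonneg
  refine Matrix.isUnit_one_sub_of_tendsto_zero
    (f := fun k u => (ℙ u).real {ω | ∃ n ≥ 2 * k, (X n ω).1 = 1}) ?_ ?_ ?_ ?_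
  · intro u v
    rw [Matrix.mul_apply]
    exact Finset.sum_nonneg fun w _ => mul_nonneg (hq _ _ _) (hq _ _ _)
  · intro u
    have := (hX u).isProbabilityMeasure
    have : (ℙ u) {ω | ∃ n ≥ 2 * 0, (X n ω).1 = 1} = 1 := by
      rw [← measure_univ (μ := ℙ u)]
      refine measure_congr ?_
      filter_upwards [(hX u).start] with ω hω
      exact propext ⟨fun _ => trivial, fun _ => ⟨0, by simp, by rw [hω]⟩⟩
    rw [measureReal_def, this, ENNReal.toReal_one]
  · intro k u
    have h1 (v : Fin r) := sum_q_mul_le hX hg g (2 * k) v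
    have h2 := sum_q_mul_le hX (inv_ne_one.2 hg) 1 (2 * k + 1) u
    simp only [mul_eq_left] at h1
    simp only [inv_mul_eq_one, eq_comm (a := g)] at h2
    calc ∑ w, (q ℙ X g⁻¹ * q ℙ X g) u w * (ℙ w).real {ω | ∃ n ≥ 2 * k, (X n ω).1 = 1}
        = ∑ v, q ℙ X g⁻¹ u v *
            ∑ w, q ℙ X g v w * (ℙ w).real {ω | ∃ n ≥ 2 * k, (X n ω).1 = 1} := by
          simp only [Matrix.mul_apply, Finset.sum_mul, Finset.mul_sum]
          rw [Finset.sum_comm]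
          simp only [mul_assoc]
      _ ≤ ∑ v, q ℙ X g⁻¹ u v * (ℙ v).real {ω | ∃ n ≥ 2 * k + 1, (X n ω).1 = g} :=
          Finset.sum_le_sum fun v _ => mul_le_mul_of_nonneg_left (h1 v) (hq _ _ _)
      _ ≤ _ := h2
  · intro u
    exact (tendsto_measureReal_visit hX htr 1 u).comp
      (tendsto_id.const_mul_atTop' (by norm_num : 0 < 2))

/-! ### The law of the first letter of the limit -/

section Tree

open ReducedWord

variable {S : Set G} (hS : IsTreeBasis S)

/-- The probability, starting from `(1, u)`, that the first letter of the limit is `g` and that the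
first visit to `g` happens with color `v`. -/
noncomputable def limitMatrix (S : Set G) (ℙ : Fin r → Measure Ω) (X : ℕ → Ω → G × Fin r) (g : G) :
    Matrix (Fin r) (Fin r) ℝ :=
  Matrix.of fun u v => (ℙ u).real
    {ω | (∃ ξ, ReducedWord.IsLimit S (fun n => (X n ω).1) ξ ∧ ξ 0 = g) ∧
      ∃ n : ℕ, tau X g ω = n ∧ X n ω = (g, v)}

/-- The trajectories whose reduced word eventually begins with `g`. -/
def cone (hS : IsTreeBasis S) (g : G) : Set (ℕ → G × Fin r) :=
  {y | ∀ᶠ n in atTop, (hS.nf (y n).1).head? = some g}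

theorem measurableSet_cone (g : G) : MeasurableSet (cone hS g : Set (ℕ → G × Fin r)) := by
  have : (cone hS g : Set (ℕ → G × Fin r)) = ⋃ N, ⋂ n, ⋂ (_ : n ≥ N),
      Function.eval n ⁻¹' {x : G × Fin r | (hS.nf x.1).head? = some g} := by
    ext y
    simp [cone, eventually_atTop]
  rw [this]
  exact .iUnion fun N => .iInter fun n => .iInter fun _ => measurable_pi_apply n .of_discrete

-- Replaces the existence of a limit, almost surely, by the event `cone`, whose measurability is
-- clear.
omit [MeasurableSpace G] [DiscreteMeasurableSpace G] in
theorem limitMatrix_apply (hnn : ∀ g, g ∉ S → p g = 0)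
    (hX : ∀ u, IsColoredWalk p u (ℙ u) X) (htr : IsTransient ℙ X) (g : G) (u v : Fin r) :
    limitMatrix S ℙ X g u v =
      (ℙ u).real ({ω | (fun n => X n ω) ∈ cone hS g} ∩ hitSet X g v) := by
  refine measureReal_congr ?_
  filter_upwards [ae_step hnn (hX u), ae_transient htr u] with ω h1 h2
  refine propext (and_congr (hS.exists_isLimit_iff h1 h2 g) (exists_tau_eq_iff X g v ω))

/-- Entering the cone of `g` forces a visit to `g`, so the colors of the first visit exhaust the
event. -/
theorem sum_limitMatrix (hnn : ∀ g, g ∉ S → p g = 0) (hX : ∀ u, IsColoredWalk p u (ℙ u) X)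
    (htr : IsTransient ℙ X) (g : G) (u : Fin r) :
    ∑ v, limitMatrix S ℙ X g u v = (ℙ u).real {ω | (fun n => X n ω) ∈ cone hS g} := by
  have := (hX u).isProbabilityMeasure
  simp only [limitMatrix_apply hS hnn hX htr]
  rw [← measureReal_biUnion_finset (f := fun v => {ω | (fun n => X n ω) ∈ cone hS g} ∩ hitSet X g v)
    (fun v _ w _ hvw => (disjoint_hitSet X g hvw).mono
    Set.inter_subset_right Set.inter_subset_right)
    (fun v _ => ((isMarkovChain (hX u)).measurable_path (measurableSet_cone hS g)).inter
      (measurableSet_hitSet (hX u) g v))]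
  refine measureReal_congr ?_
  filter_upwards [ae_step hnn (hX u), (hX u).start] with ω h1 h0
  refine propext ⟨fun h => ?_, fun h => ?_⟩
  · obtain ⟨v, -, hv⟩ := Set.mem_iUnion₂.1 h
    exact hv.1
  · obtain ⟨n, hn⟩ := Eventually.exists h
    obtain ⟨k, hk⟩ := hS.exists_eq_of_head? (x := fun n => (X n ω).1) h1 (by simp [h0]) hn
    obtain ⟨v, hv⟩ := exists_mem_hitSet X hk
    exact Set.mem_iUnion₂.2 ⟨v, Finset.mem_univ v, h, hv⟩

include hS in
/-- The limit starts with `g` if and only if the walk visits `g` and, seen from the first visit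
to `g`, its limit does not start with `g⁻¹`. -/
theorem limitMatrix_eq_mul (hnn : ∀ g, g ∉ S → p g = 0) (hX : ∀ u, IsColoredWalk p u (ℙ u) X)
    (htr : IsTransient ℙ X) {g : G} (hg : g ∈ S) (u v : Fin r) :
    limitMatrix S ℙ X g u v = q ℙ X g u v * (1 - ∑ w, limitMatrix S ℙ X g⁻¹ v w) := by
  have := (hX v).isProbabilityMeasure
  have hset : {ω | (fun n => X n ω) ∈ cone hS g} ∩ hitSet X g v = hitThen X g v (cone hS g) := by
    -- The cone is a tail event, so it does not matter whether time is counted from 0 or from the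
    -- first visit to `g`.
    have hshift (ω : Ω) (n : ℕ) : (fun k => X (n + k) ω) ∈ (cone hS g : Set (ℕ → G × Fin r)) ↔
        (fun k => X k ω) ∈ (cone hS g : Set (ℕ → G × Fin r)) := by
      simp only [cone, Set.mem_ofPred_eq, add_comm n]
      rw [← eventually_map (m := fun k => k + n) (P := fun k => (hS.nf (X k ω).1).head? = some g),
        map_add_atTop_eq_nat]
    ext ω
    constructor
    · rintro ⟨h, n, h1, h2⟩
      exact ⟨n, h1, h2, (hshift ω n).2 h⟩
    · rintro ⟨n, h1, h2, h⟩
      exact ⟨(hshift ω n).1 h, n, h1, h2⟩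
  rw [limitMatrix_apply hS hnn hX htr, hset, measureReal_hitThen hX g u v (measurableSet_cone hS g),
    sum_limitMatrix hS hnn hX htr, ← probReal_compl_eq_one_sub
      (s := {ω | (fun n => X n ω) ∈ cone hS g⁻¹})
      ((isMarkovChain (hX v)).measurable_path (measurableSet_cone hS g⁻¹))]
  congr 1
  refine measureReal_congr ?_
  filter_upwards [ae_step hnn (hX v), ae_transient htr v] with ω h1 h2
  exact propext (hS.eventually_head?_mul h1 h2 hg)

include hS in
theorem limitMatrix_eq (hnn : ∀ g, g ∉ S → p g = 0) (hX : ∀ u, IsColoredWalk p u (ℙ u) X)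
    (htr : IsTransient ℙ X) {g : G} (hg : g ∈ S) (u v : Fin r) :
    limitMatrix S ℙ X g u v = q ℙ X g u v *
      ∑ w, ((1 - q ℙ X g⁻¹ * q ℙ X g)⁻¹ * (1 - dmat ℙ X g⁻¹)) v w := by
  have hunit := isUnit_one_sub_q_mul_q hX htr (hS.ne_one_of_mem hg)
  set h : Fin r → ℝ := fun v => 1 - ∑ w, limitMatrix S ℙ X g⁻¹ v w with hh
  have hsum : (fun w => ∑ t, limitMatrix S ℙ X g w t) = (q ℙ X g).mulVec h := by
    funext w
    exact Finset.sum_congr rfl fun t _ => limitMatrix_eq_mul hS hnn hX htr hg w t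
  -- The relation between the two matrices is used for both `g` and `g⁻¹`, which closes the linear
  -- system for `h`.
  have hrec : (1 - q ℙ X g⁻¹ * q ℙ X g).mulVec h = (1 - dmat ℙ X g⁻¹).mulVec 1 := by
    rw [Matrix.sub_mulVec, Matrix.sub_mulVec, Matrix.one_mulVec, Matrix.one_mulVec,
      ← Matrix.mulVec_mulVec, ← hsum]
    funext v
    rw [Pi.sub_apply, Pi.sub_apply, dmat, Matrix.mulVec_diagonal]
    simp only [hh, limitMatrix_eq_mul hS hnn hX htr (hS.inv_mem g hg), inv_inv, Matrix.mulVec,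
      dotProduct, mul_sub, Finset.sum_sub_distrib, Pi.one_apply, mul_one]
    ring
  have hsol : h = ((1 - q ℙ X g⁻¹ * q ℙ X g)⁻¹ * (1 - dmat ℙ X g⁻¹)).mulVec 1 := by
    rw [← Matrix.mulVec_mulVec, ← hrec, Matrix.mulVec_mulVec,
      Matrix.nonsing_inv_mul _ ((Matrix.isUnit_iff_isUnit_det _).1 hunit), Matrix.one_mulVec]
  rw [limitMatrix_eq_mul hS hnn hX htr hg]
  change _ * h v = _
  rw [hsol]
  simp [Matrix.mulVec, dotProduct]

end Tree

end Walk

end ColoredWalk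

theorem mainTheorem9 {d m r : ℕ} {Ω : Type*} [MeasurableSpace Ω]
    (p : FreeGp d m → Matrix (Fin r) (Fin r) ℝ) (hp : IsColoredKernel p)
    (hnn : ∀ g, g ∉ FreeGp.S d m → p g = 0)
    (ℙ : Fin r → Measure Ω) (X : ℕ → Ω → FreeGp d m × Fin r)
    (hX : ∀ u, IsColoredWalk p u (ℙ u) X)
    (htr : ColoredWalk.IsTransient ℙ X) :
    (∀ u, ∀ᵐ ω ∂ℙ u, ∃! ξ : ℕ → FreeGp d m, ColoredWalk.IsLimit X ω ξ) ∧
    ∀ g ∈ FreeGp.S d m,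
      IsUnit (1 - ColoredWalk.q ℙ X g⁻¹ * ColoredWalk.q ℙ X g) ∧
      ∀ u v, ColoredWalk.mu ℙ X g u v =
        ColoredWalk.q ℙ X g u v *
          ∑ w, ((1 - ColoredWalk.q ℙ X g⁻¹ * ColoredWalk.q ℙ X g)⁻¹ *
            (1 - ColoredWalk.dmat ℙ X g⁻¹)) v w := by
  -- The group is countable, so the discrete σ-algebra serves for path space.
  let _ : MeasurableSpace (FreeGp d m) := ⊤
  have hS := FreeGp.isTreeBasis d m
  refine ⟨fun u => ?_, fun g hg => ⟨?_, fun u v => ?_⟩⟩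
  · filter_upwards [ColoredWalk.ae_step hnn (hX u), ColoredWalk.ae_transient htr u] with ω h1 h2
    exact hS.existsUnique_isLimit h1 h2
  · exact ColoredWalk.isUnit_one_sub_q_mul_q hX htr (hS.ne_one_of_mem hg)
  -- For `FreeGp.S`, the definitions of `limitMatrix` and `mu` unfold to the same matrix.
  · exact ColoredWalk.limitMatrix_eq hS hnn hX htr hg u v
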